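/- Let $\mu(\mathbf r)=\sum_{\mathbf k\in\Lambda}c[\mathbf k]\,e^{j2\pi\langle\mathbf k,\mathbf r\rangle}$, $\mathbf r\in\mathbb R^2$, be a trigonometric polynomial, where $\Lambda\subset\mathbb Z^2$ is finite and $c[\mathbf k]\in\mathbb C$. Let $a_1,a_2,b$ be complex-valued smooth functions on $\mathbb R^2$ which, together with each of their derivatives, grow at most polynomially (for example constants). Differential operators are applied to integrable functions in the sense of tempered distributions, and Fourier transforms are normalized by $\widehat f(\boldsymbol\omega)=\int_{\mathbb R^2} f(\mathbf r)e^{-j\langle\boldsymbol\omega,\mathbf r\rangle}\,d\mathbf r$. (1) Let $D=a_1\partial_x+a_2\partial_y$, and let $\Omega\subset[0,1]^2$ be a Lebesgue measurable set (for instance a simply connected region with piecewise smooth boundary) whose topological boundary in $\mathbb R^2$ satisfies $\partial\Omega\subset\{\mu=0\}$. Put $f=\chi_\Omega$. Then $f$ is integrable, the Fourier transform $\widehat{Df}$ of the tempered distribution $Df$ is a continuous function on $\mathbb R^2$, and $$\sum_{\mathbf k\in\Lambda}c[\mathbf k]\,\widehat{Df}(\boldsymbol\omega-2\pi\mathbf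 k)=0\qquad\text{for all }\boldsymbol\omega\in\mathbb R^2.$$ (2) More generally, let $D=a_1\partial_x+a_2\partial_y+b$, let $\Omega_1,\dots,\Omega_n\subset[0,1]^2$ be Lebesgue measurable sets with $\partial\Omega_i\subset\{\mu=0\}$ for every $i$, and let $g_1,\dots,g_n$ be complex-valued functions such that $g_i$ is smooth at every point of $\overline{\Omega_i}$ and $Dg_i=0$ on $\Omega_i$. Put $f=\sum_{i=1}^n g_i\chi_{\Omega_i}$. Then $f$ is integrable, $\widehat{Df}$ is a continuous function on $\mathbb R^2$, and the same identity holds for all $\boldsymbol\omega\in\mathbb R^2$. -/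

import Mathlib

open MeasureTheory
open scoped SchwartzMap FourierTransform LineDeriv ContDiff

/-- The plane `ℝ²` with its Euclidean structure. -/
abbrev Plane : Type := EuclideanSpace ℝ (Fin 2)

/-- The closed unit square `[0,1]²`. -/
def unitSquare : Set Plane := {r | ∀ i, r i ∈ Set.Icc (0 : ℝ) 1}

/-- The trigonometric polynomial `μ(r) = ∑_{k ∈ Λ} c[k] exp(2πj ⟨k, r⟩)`. -/
noncomputable def trigPoly (Λ : Finset (Fin 2 → ℤ)) (c : (Fin 2 → ℤ) → ℂ) (r : Plane) : ℂ :=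
  ∑ k ∈ Λ, c k * Complex.exp (2 * Real.pi * Complex.I * ((∑ i, (k i : ℝ) * r i : ℝ) : ℂ))

/-- The `i`-th standard basis vector of the plane. -/
noncomputable def basisVec (i : Fin 2) : Plane := EuclideanSpace.single i (1 : ℝ)

/-- The first-order operator `D = a₀ ∂_x + a₁ ∂_y + b`, acting classically on a function. -/
noncomputable def diffOp (a : Fin 2 → Plane → ℂ) (b : Plane → ℂ) (g : Plane → ℂ) (r : Plane) : ℂ :=
  ∑ i, a i r * fderiv ℝ g r (basisVec i) + b r * g r

/-- The first-order operator `D = a₀ ∂_x + a₁ ∂_y + b`, acting on tempered distributions.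
The coefficients are meant to be smooth functions of temperate growth. -/
noncomputable def diffOpDist (a : Fin 2 → Plane → ℂ) (b : Plane → ℂ) (T : 𝓢'(Plane, ℂ)) :
    𝓢'(Plane, ℂ) :=
  ∑ i, TemperedDistribution.smulLeftCLM ℂ (a i) (∂_{basisVec i} T) +
    TemperedDistribution.smulLeftCLM ℂ b T

/-- The tempered distribution `φ ↦ ∫ φ f` of an integrable function `f`. -/
noncomputable def regularDist (f : Plane → ℂ) (hf : Integrable f volume) : 𝓢'(Plane, ℂ) :=
  Lp.toTemperedDistribution (hf.toL1 f)

/-- The Fourier transform of the tempered distribution `T` is the continuous function `F`, in the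
convention `F(ω) = ∫ f(r) exp(-j ⟨ω, r⟩) dr` when `T` is the integrable function `f`.
Mathlib's `𝓕` has the kernel `exp(-2πj ⟨ξ, r⟩)`, so that `𝓕 T` is the function `ξ ↦ F(2πξ)`.
There is at most one such `F`. -/
def IsFourierTransform (T : 𝓢'(Plane, ℂ)) (F : Plane → ℂ) : Prop :=
  Continuous F ∧ ∀ φ : 𝓢(Plane, ℂ),
    Integrable (fun ξ : Plane => φ ξ * F ((2 * Real.pi) • ξ)) volume ∧
      (𝓕 T) φ = ∫ ξ : Plane, φ ξ * F ((2 * Real.pi) • ξ)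

/-- The frequency vector `2πk`. -/
noncomputable def freq (k : Fin 2 → ℤ) : Plane :=
  WithLp.toLp 2 (fun i => 2 * Real.pi * (k i : ℝ))

/-- The Fourier transform of `T` is a continuous function `F`, and this function satisfies
`∑_{k ∈ Λ} c[k] F(ω - 2πk) = 0` at every frequency `w`. -/
def FourierAnnihilated (Λ : Finset (Fin 2 → ℤ)) (c : (Fin 2 → ℤ) → ℂ) (T : 𝓢'(Plane, ℂ)) : Prop :=
  (∃ F, IsFourierTransform T F) ∧
    ∀ F, IsFourierTransform T F → ∀ w : Plane, ∑ k ∈ Λ, c k * F (w - freq k) = 0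

/-! Write `e` for the plane wave of frequency `w`. In divergence form `D f = (b - ∑ ∂ⱼaⱼ) f + ∑
∂ⱼ(aⱼ f)`, with integrable terms, so its transform is an explicit continuous function. Since `D gᵢ =
0`, its value at `w` is `-∑ᵢ ∑ⱼ ∫_{Ωᵢ} ∂ⱼ(aⱼ gᵢ e)` (`firstOrderFourier_eq_sum_integral_indicator`).
Summing over shifts by `2πk` with weights `c k` replaces `e` by `e μ`, which vanishes on each
frontier. It remains to see that `∫_Ω ∂ⱼh = 0` when `h = 0` on `∂Ω`, with no regularity of `∂Ω`
(`integral_indicator_fderiv_eq_zero`). On each line the truncation of `h` is continuous, and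
differentiable except at zeros of `h` with nonzero derivative. These are countably many, so the
fundamental theorem of calculus still applies. -/

/-! ### Truncated functions on the line. -/

open Filter Topology Set in
/-- A function with nonzero derivative at a zero has that zero isolated, so there are only countably
many such zeros. -/
theorem countable_zeros_of_hasDerivAt_ne_zero (h h' : ℝ → ℂ) :
    {t | h t = 0 ∧ h' t ≠ 0 ∧ HasDerivAt h (h' t) t}.Countable := by
  set s := {t | h t = 0 ∧ h' t ≠ 0 ∧ HasDerivAt h (h' t) t}
  refine (countable_setOfPred_isolated_right_within (s := s)).mono ?_
  intro t ht
  refine ⟨ht, ?_⟩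
  have h1 : ∀ᶠ z in 𝓝[≠] t, h z ≠ 0 := ht.2.2.eventually_ne ht.2.1
  have h2 : 𝓝[s ∩ Ioi t] t ≤ 𝓝[≠] t := nhdsWithin_mono _ fun z hz => hz.2.ne'
  rw [← empty_mem_iff_bot]
  filter_upwards [h2 h1, self_mem_nhdsWithin] with z hz hz'
  exact hz hz'.1.1

open Filter Topology Set in
/-- Truncating a function to a set keeps its derivative where the function vanishes on the
frontier, apart from frontier points at which the derivative does not vanish. -/
theorem hasDerivAt_indicator {S : Set ℝ} {h h' : ℝ → ℂ}
    (hd : ∀ t ∈ closure S, HasDerivAt h (h' t) t) (h0 : ∀ t ∈ frontier S, h t = 0) {t : ℝ}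
    (ht : t ∈ frontier S → h' t = 0) : HasDerivAt (S.indicator h) (S.indicator h' t) t := by
  by_cases hf : t ∈ frontier S
  · have hz : S.indicator h' t = 0 := by
      by_cases hS : t ∈ S <;> simp [hS, ht hf]
    have h1 := hd t (frontier_subset_closure hf)
    rw [ht hf] at h1
    rw [hz]
    rw [hasDerivAt_iff_isLittleO] at h1 ⊢
    have e0 : S.indicator h t = 0 := by by_cases hS : t ∈ S <;> simp [hS, h0 t hf]
    -- Truncation only decreases the norm, so the bound `h x = o(x - t)` passes to the truncated
    -- function.
    refine (Asymptotics.IsBigO.of_bound 1 (Eventually.of_forall fun x => ?_)).trans_isLittleO h1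
    simpa [e0, h0 t hf] using norm_indicator_le_norm_self h x
  · by_cases hS : t ∈ closure S
    · have hi : t ∈ interior S := by
        by_contra hn; exact hf ⟨hS, hn⟩
      rw [indicator_of_mem (interior_subset hi)]
      refine (hd t hS).congr_of_eventuallyEq ?_
      filter_upwards [mem_interior_iff_mem_nhds.1 hi] with x hx using indicator_of_mem hx h
    · rw [indicator_of_notMem (fun h => hS (subset_closure h))]
      refine (hasDerivAt_const t (0 : ℂ)).congr_of_eventuallyEq ?_
      filter_upwards [isClosed_closure.isOpen_compl.mem_nhds hS] with x hx
      exact indicator_of_notMem (fun h => hx (subset_closure h)) h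

open Filter Topology Set in
theorem continuous_indicator_of_frontier_eq_zero {X : Type*} [TopologicalSpace X] {S : Set X}
    {h : X → ℂ} (hd : ContinuousOn h (closure S)) (h0 : ∀ t ∈ frontier S, h t = 0) :
    Continuous (S.indicator h) := by
  classical
  exact continuous_indicator h0 hd

open Filter Topology Set in
theorem integral_indicator_deriv_eq_zero {S : Set ℝ} (hS : Bornology.IsBounded S) {h h' : ℝ → ℂ}
    (hd : ∀ t ∈ closure S, HasDerivAt h (h' t) t) (h0 : ∀ t ∈ frontier S, h t = 0) :
    ∫ t, S.indicator h' t = 0 := by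
  -- A non-integrable function has integral zero by convention, so slices need not be checked for
  -- measurability.
  by_cases hi : Integrable (S.indicator h') volume
  swap
  · exact integral_undef hi
  obtain ⟨R, hR⟩ := hS.subset_closedBall 0
  -- The margin 1 puts both endpoints outside `S`, where the truncation is zero.
  have hsub : S ⊆ Ioo (-(|R| + 1)) (|R| + 1) := fun x hx => by
    have := hR hx
    simp only [Metric.mem_closedBall, dist_zero_right, Real.norm_eq_abs] at this
    have := this.trans (le_abs_self R)
    exact abs_lt.1 (by linarith)
  have hle : -(|R| + 1) ≤ |R| + 1 := by linarith [abs_nonneg R]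
  have hc : Continuous (S.indicator h) := continuous_indicator_of_frontier_eq_zero
    (fun t ht => (hd t ht).continuousAt.continuousWithinAt) h0
  have key := integral_eq_of_hasDerivAt_off_countable_of_le (S.indicator h) (S.indicator h') hle
    (countable_zeros_of_hasDerivAt_ne_zero h h') hc.continuousOn
    (fun t ht => hasDerivAt_indicator hd h0 fun hf => by
      by_contra hne
      exact ht.2 ⟨h0 t hf, hne, hd t (frontier_subset_closure hf)⟩) hi.intervalIntegrable
  rw [indicator_of_notMem (fun h => lt_irrefl _ (hsub h).1),
    indicator_of_notMem (fun h => lt_irrefl _ (hsub h).2), sub_zero,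
    intervalIntegral.integral_of_le hle, setIntegral_eq_integral_of_forall_compl_eq_zero] at key
  · exact key
  · intro x hx
    exact indicator_of_notMem (fun h => hx (Ioo_subset_Ioc_self (hsub h))) h'

/-! ### Integrals of derivatives over plane sets. -/

theorem integrable_indicator_of_continuousOn_closure {Ω : Set Plane}
    (hm : NullMeasurableSet Ω volume) (hb : Bornology.IsBounded Ω) {h : Plane → ℂ}
    (hc : ContinuousOn h (closure Ω)) : Integrable (Ω.indicator h) volume :=
  ((hc.integrableOn_compact hb.isCompact_closure).mono_set subset_closure).integrable_indicator₀ hm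

theorem hasDerivAt_toLp_insertNth (i : Fin 2) (y : Fin 1 → ℝ) (t : ℝ) :
    HasDerivAt (fun t => (WithLp.toLp 2 (i.insertNth (α := fun _ => ℝ) t y) : Plane))
      (basisVec i) t := by
  have h : HasDerivAt (fun t : ℝ => (WithLp.toLp 2 (i.insertNth (α := fun _ => ℝ) 0 y) : Plane) +
      t • basisVec i) ((1 : ℝ) • basisVec i) t :=
    ((hasDerivAt_id t).smul_const _).const_add _
  rw [one_smul] at h
  convert h using 1
  ext s j
  refine Fin.succAboveCases i ?_ (fun j => ?_) j <;> simp [basisVec]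

/-- Integration over the plane, first along the lines parallel to a coordinate axis. -/
theorem integral_plane_eq {G : Plane → ℂ} (hG : Integrable G volume) (i : Fin 2) :
    ∫ r, G r = ∫ y : Fin 1 → ℝ, ∫ t : ℝ,
      G (WithLp.toLp 2 (i.insertNth (α := fun _ => ℝ) t y)) := by
  have h1 : MeasurePreserving (fun p : ℝ × (Fin 1 → ℝ) =>
      (WithLp.toLp 2 (i.insertNth (α := fun _ => ℝ) p.1 p.2) : Plane)) :=
    (PiLp.volume_preserving_toLp (Fin 2)).comp
      (volume_preserving_piFinSuccAbove (fun _ => ℝ) i).symm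
  have h2 : MeasurableEmbedding (fun p : ℝ × (Fin 1 → ℝ) =>
      (WithLp.toLp 2 (i.insertNth (α := fun _ => ℝ) p.1 p.2) : Plane)) :=
    (MeasurableEquiv.toLp 2 (Fin 2 → ℝ)).measurableEmbedding.comp
      (MeasurableEquiv.piFinSuccAbove (fun _ => ℝ) i).symm.measurableEmbedding
  rw [← h1.integral_comp h2 G]
  exact integral_prod_symm _ ((h1.integrable_comp_emb h2).2 hG)

/-- Fubini reduces this to lines: the closure and frontier of a slice lie in the slices of the
closure and frontier, so the one-dimensional result applies on every line. -/
theorem integral_indicator_fderiv_eq_zero {Ω : Set Plane} (hm : NullMeasurableSet Ω volume)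
    (hb : Bornology.IsBounded Ω) {h : Plane → ℂ} (hd : ∀ r ∈ closure Ω, ContDiffAt ℝ 1 h r)
    (h0 : ∀ r ∈ frontier Ω, h r = 0) (i : Fin 2) :
    ∫ r, Ω.indicator (fun r => fderiv ℝ h r (basisVec i)) r = 0 := by
  rw [integral_plane_eq (integrable_indicator_of_continuousOn_closure hm hb ?_) i]
  · refine integral_eq_zero_of_ae (Filter.Eventually.of_forall fun y => ?_)
    have hγ := hasDerivAt_toLp_insertNth i y
    set γ := fun t : ℝ => (WithLp.toLp 2 (i.insertNth (α := fun _ => ℝ) t y) : Plane)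
    have hγc : Continuous γ := continuous_iff_continuousAt.2 fun t => (hγ t).continuousAt
    refine integral_indicator_deriv_eq_zero (S := γ ⁻¹' Ω) (h := h ∘ γ)
      (h' := fun t => fderiv ℝ h (γ t) (basisVec i)) ?_ ?_ ?_
    · obtain ⟨R, hR⟩ := hb.subset_closedBall 0
      refine (Metric.isBounded_closedBall (x := (0 : ℝ)) (r := R)).subset fun t ht => ?_
      have h1 := hR ht
      have h2 := PiLp.norm_apply_le (γ t) i
      simp only [γ, Fin.insertNth_apply_same] at h2
      simp only [Metric.mem_closedBall, dist_zero_right] at h1 ⊢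
      exact h2.trans h1
    · intro t ht
      exact ((hd _ (hγc.closure_preimage_subset _ ht)).differentiableAt
        one_ne_zero).hasFDerivAt.comp_hasDerivAt t (hγ t)
    · exact fun t ht => h0 _ (hγc.frontier_preimage_subset _ ht)
  · intro r hr
    exact (((hd r hr).fderiv_right (m := 0) (by norm_num)).continuousAt.clm_apply
      continuousAt_const).continuousWithinAt

/-! ### Fourier transforms of first-order distributions. -/

theorem regularDist_apply {f : Plane → ℂ} (hf : Integrable f volume) (φ : 𝓢(Plane, ℂ)) :
    regularDist f hf φ = ∫ r, φ r * f r := by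
  rw [regularDist, Lp.toTemperedDistribution_apply]
  refine integral_congr_ae ?_
  filter_upwards [hf.coeFn_toL1] with r hr
  rw [hr, smul_eq_mul]

theorem diffOpDist_regularDist_apply {a : Fin 2 → Plane → ℂ} (ha : ∀ i, (a i).HasTemperateGrowth)
    {b : Plane → ℂ} (hb : b.HasTemperateGrowth) {f : Plane → ℂ} (hf : Integrable f volume)
    (φ : 𝓢(Plane, ℂ)) :
    diffOpDist a b (regularDist f hf) φ =
      -(∑ i, ∫ r, fderiv ℝ (fun x => a i x * φ x) r (basisVec i) * f r) +
        ∫ r, b r * φ r * f r := by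
  have h (i : Fin 2) : TemperedDistribution.smulLeftCLM ℂ (a i) (∂_{basisVec i} (regularDist f hf)) φ
      = -∫ r, fderiv ℝ (fun x => a i x * φ x) r (basisVec i) * f r := by
    rw [TemperedDistribution.smulLeftCLM_apply_apply, TemperedDistribution.lineDerivOp_apply_apply]
    simp only [map_neg, regularDist_apply, SchwartzMap.lineDerivOp_apply_eq_fderiv,
      SchwartzMap.smulLeftCLM_apply (ha i), smul_eq_mul]
  have h' : TemperedDistribution.smulLeftCLM ℂ b (regularDist f hf) φ = ∫ r, b r * φ r * f r := by
    rw [TemperedDistribution.smulLeftCLM_apply_apply]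
    simp only [regularDist_apply, SchwartzMap.smulLeftCLM_apply hb, smul_eq_mul]
  rw [← h', ← Finset.sum_neg_distrib]
  rw [← Finset.sum_congr rfl fun i _ => h i]
  simp only [diffOpDist, Fin.sum_univ_two]
  rfl

/-- The Fourier transform `ω ↦ p̂(ω) + ∑ᵢ j ωᵢ q̂ᵢ(ω)` of the distribution `p + ∑ᵢ ∂ᵢ qᵢ`. -/
noncomputable def firstOrderFourier (p : Plane → ℂ) (q : Fin 2 → Plane → ℂ) (w : Plane) : ℂ :=
  𝓕 p ((2 * Real.pi)⁻¹ • w) + ∑ i, Complex.I * (w i : ℂ) * 𝓕 (q i) ((2 * Real.pi)⁻¹ • w)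

theorem continuous_fourier_of_integrable {p : Plane → ℂ} (hp : Integrable p volume) :
    Continuous (𝓕 p) :=
  VectorFourier.fourierIntegral_continuous Real.continuous_fourierChar
    (L := innerₗ Plane) (by exact continuous_inner) hp

theorem norm_fourier_le_integral_norm (p : Plane → ℂ) (ξ : Plane) : ‖𝓕 p ξ‖ ≤ ∫ r, ‖p r‖ :=
  VectorFourier.norm_fourierIntegral_le_integral_norm _ _ _ _ _

theorem integrable_schwartz_mul_fourier {p : Plane → ℂ} (hp : Integrable p volume)
    (φ : 𝓢(Plane, ℂ)) : Integrable (fun ξ => φ ξ * 𝓕 p ξ) volume :=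
  φ.integrable.mul_bdd (continuous_fourier_of_integrable hp).aestronglyMeasurable
    (Filter.Eventually.of_forall fun ξ => norm_fourier_le_integral_norm p ξ)

theorem integral_fourier_schwartz_mul {p : Plane → ℂ} (hp : Integrable p volume)
    (φ : 𝓢(Plane, ℂ)) : ∫ r, (𝓕 φ : 𝓢(Plane, ℂ)) r * p r = ∫ ξ, φ ξ * 𝓕 p ξ := by
  have h := VectorFourier.integral_fourierIntegral_smul_eq_flip (L := innerₗ Plane)
    (f := (φ : Plane → ℂ)) (g := p) (μ := volume) (ν := volume) Real.continuous_fourierChar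
    (by exact continuous_inner) φ.integrable hp
  rw [flip_innerₗ] at h
  simp only [smul_eq_mul] at h
  rw [SchwartzMap.fourier_coe]
  exact h

theorem integrable_schwartz_mul {p : Plane → ℂ} (hp : Integrable p volume)
    (φ : 𝓢(Plane, ℂ)) : Integrable (fun ξ => φ ξ * p ξ) volume := by
  obtain ⟨C, hC⟩ := φ.decay 0 0
  refine hp.bdd_mul (c := C) φ.continuous.aestronglyMeasurable
    (Filter.Eventually.of_forall fun ξ => ?_)
  simpa using hC.2 ξ

theorem inner_basisVec (ξ : Plane) (i : Fin 2) : inner ℝ ξ (basisVec i) = ξ i := by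
  simp [basisVec, EuclideanSpace.inner_single_right]

/-- The distribution `p + ∑ᵢ ∂ᵢ qᵢ` with integrable `p`, `qᵢ` has a continuous Fourier transform. -/
theorem isFourierTransform_firstOrderFourier {p : Plane → ℂ} {q : Fin 2 → Plane → ℂ}
    (hp : Integrable p volume) (hq : ∀ i, Integrable (q i) volume) {T : 𝓢'(Plane, ℂ)}
    (hT : ∀ φ : 𝓢(Plane, ℂ), T φ =
      (∫ r, φ r * p r) - ∑ i, ∫ r, (∂_{basisVec i} φ) r * q i r) :
    IsFourierTransform T (firstOrderFourier p q) := by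
  have hc : Continuous (firstOrderFourier p q) := by
    have h1 := continuous_fourier_of_integrable hp
    have h2 := fun i => continuous_fourier_of_integrable (hq i)
    unfold firstOrderFourier
    fun_prop
  have hg (i : Fin 2) : (fun ξ : Plane => (inner ℝ ξ (basisVec i) : ℝ)).HasTemperateGrowth := by
    fun_prop
  -- Chosen so that `𝓕 (ψ φ i) = ∂ᵢ (𝓕 φ)`.
  let ψ (φ : 𝓢(Plane, ℂ)) (i : Fin 2) : 𝓢(Plane, ℂ) :=
    -(2 * Real.pi * Complex.I) • SchwartzMap.smulLeftCLM ℂ (inner ℝ · (basisVec i)) φ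
  have hψ (φ : 𝓢(Plane, ℂ)) (i : Fin 2) (ξ : Plane) :
      ψ φ i ξ = -(2 * Real.pi * Complex.I) * (ξ i * φ ξ) := by
    rw [← inner_basisVec ξ i]
    simp only [ψ, smul_apply, SchwartzMap.smulLeftCLM_apply_apply (hg i), smul_eq_mul,
      Complex.real_smul]
  have hF (φ : 𝓢(Plane, ℂ)) (ξ : Plane) : φ ξ * firstOrderFourier p q ((2 * Real.pi) • ξ) =
      φ ξ * 𝓕 p ξ - ∑ i, ψ φ i ξ * 𝓕 (q i) ξ := by
    have h0 : (2 * Real.pi)⁻¹ • (2 * Real.pi) • ξ = ξ := by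
      rw [smul_smul, inv_mul_cancel₀ Real.two_pi_pos.ne', one_smul]
    simp only [firstOrderFourier, h0, hψ, Fin.sum_univ_two, PiLp.smul_apply, smul_eq_mul]
    push_cast
    ring
  refine ⟨hc, fun φ => ⟨?_, ?_⟩⟩
  · simp only [hF]
    exact (integrable_schwartz_mul_fourier hp φ).sub
      (integrable_finsetSum _ fun i _ => integrable_schwartz_mul_fourier (hq i) _)
  · simp only [hF]
    rw [integral_sub (integrable_schwartz_mul_fourier hp φ)
      (integrable_finsetSum _ fun i _ => integrable_schwartz_mul_fourier (hq i) _),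
      integral_finsetSum _ fun i _ => integrable_schwartz_mul_fourier (hq i) _,
      TemperedDistribution.fourier_apply, hT, integral_fourier_schwartz_mul hp]
    congr 1
    refine Finset.sum_congr rfl fun i _ => ?_
    rw [SchwartzMap.lineDerivOp_fourier_eq, integral_fourier_schwartz_mul (hq i)]

/-- Compactly supported smooth test functions determine `F` almost everywhere, hence everywhere by
continuity. The annihilation identity then need only be checked for one explicit `F`. -/
theorem IsFourierTransform.unique {T : 𝓢'(Plane, ℂ)} {F G : Plane → ℂ}
    (hF : IsFourierTransform T F) (hG : IsFourierTransform T G) : F = G := by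
  have hc {H : Plane → ℂ} (hH : Continuous H) :
      Continuous fun ξ : Plane => H ((2 * Real.pi) • ξ) := by fun_prop
  have h := ae_eq_of_integral_contDiff_smul_eq (μ := (volume : Measure Plane))
    (hc hF.1).locallyIntegrable (hc hG.1).locallyIntegrable fun g g_smooth g_cpt => by
      have hg₁ : HasCompactSupport (Complex.ofRealCLM ∘ g) := g_cpt.comp_left rfl
      have hg₂ : ContDiff ℝ ∞ (Complex.ofRealCLM ∘ g) := by fun_prop
      simpa using (hF.2 (hg₁.toSchwartzMap hg₂)).2.symm.trans (hG.2 (hg₁.toSchwartzMap hg₂)).2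
  have h' := (Continuous.ae_eq_iff_eq volume (hc hF.1) (hc hG.1)).1 h
  funext w
  have := congrFun h' ((2 * Real.pi)⁻¹ • w)
  simpa only [smul_smul, mul_inv_cancel₀ Real.two_pi_pos.ne', one_smul] using this

/-! ### Plane waves and frequency shifts. -/

theorem isBounded_unitSquare : Bornology.IsBounded unitSquare := by
  refine (Metric.isBounded_closedBall (x := (0 : Plane)) (r := 2)).subset fun r hr => ?_
  have h0 := hr 0
  have h1 := hr 1
  rw [Metric.mem_closedBall, dist_zero_right, EuclideanSpace.norm_eq, Real.sqrt_le_left (by norm_num)]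
  simp only [Fin.sum_univ_two, Real.norm_eq_abs, sq_abs]
  nlinarith [h0.1, h0.2, h1.1, h1.2]

/-- The plane wave `r ↦ exp(-j ⟨w, r⟩)`. -/
noncomputable def planeWave (w r : Plane) : ℂ :=
  Complex.exp (-(Complex.I * ((inner ℝ w r : ℝ) : ℂ)))

theorem contDiff_planeWave (w : Plane) : ContDiff ℝ ∞ (planeWave w) := by
  have : ContDiff ℝ ∞ fun r : Plane => ((inner ℝ w r : ℝ) : ℂ) :=
    Complex.ofRealCLM.contDiff.comp (contDiff_const.inner ℝ contDiff_id)
  exact (contDiff_const.mul this).neg.cexp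

theorem fderiv_planeWave (w r : Plane) (i : Fin 2) :
    fderiv ℝ (planeWave w) r (basisVec i) = -(Complex.I * w i) * planeWave w r := by
  have h1 : HasFDerivAt (fun r : Plane => ((inner ℝ w r : ℝ) : ℂ))
      (Complex.ofRealCLM.comp (innerSL ℝ w)) r :=
    (Complex.ofRealCLM.comp (innerSL ℝ w)).hasFDerivAt
  have h2 : HasFDerivAt (planeWave w) _ r := (h1.const_mul Complex.I).neg.cexp
  rw [h2.fderiv]
  simp [planeWave, inner_basisVec]
  ring

theorem fourier_eq_integral_planeWave (p : Plane → ℂ) (w : Plane) :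
    𝓕 p ((2 * Real.pi)⁻¹ • w) = ∫ r, planeWave w r * p r := by
  rw [Real.fourier_eq']
  refine integral_congr_ae (Filter.Eventually.of_forall fun r => ?_)
  have : -2 * Real.pi * inner ℝ r ((2 * Real.pi)⁻¹ • w) = -inner ℝ w r := by
    rw [inner_smul_right, real_inner_comm]
    field_simp
  simp only [this, planeWave, smul_eq_mul]
  congr 2
  push_cast
  ring

/-- This is where `μ` enters: a shift by `2πk` in frequency multiplies the wave by `exp(2πj ⟨k,
r⟩)`. -/
theorem sum_mul_planeWave_sub_freq (Λ : Finset (Fin 2 → ℤ)) (c : (Fin 2 → ℤ) → ℂ) (w r : Plane) :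
    ∑ k ∈ Λ, c k * planeWave (w - freq k) r = planeWave w r * trigPoly Λ c r := by
  rw [trigPoly, Finset.mul_sum]
  refine Finset.sum_congr rfl fun k _ => ?_
  rw [mul_left_comm, planeWave, planeWave, ← Complex.exp_add]
  congr 2
  rw [inner_sub_left]
  simp only [freq, PiLp.inner_apply, RCLike.inner_apply, conj_trivial, Fin.sum_univ_two]
  push_cast
  ring

theorem integrable_planeWave_mul {p : Plane → ℂ} (hp : Integrable p volume) (w : Plane) :
    Integrable (fun r => planeWave w r * p r) volume := by
  refine hp.bdd_mul (c := 1) (contDiff_planeWave w).continuous.aestronglyMeasurable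
    (Filter.Eventually.of_forall fun r => ?_)
  simp [planeWave, Complex.norm_exp]

theorem firstOrderFourier_eq_integral {p : Plane → ℂ} {q : Fin 2 → Plane → ℂ}
    (hp : Integrable p volume) (hq : ∀ i, Integrable (q i) volume) (w : Plane) :
    firstOrderFourier p q w =
      ∫ r, planeWave w r * (p r + ∑ i, Complex.I * (w i : ℂ) * q i r) := by
  have h (i : Fin 2) : Integrable (fun r => Complex.I * (w i : ℂ) * (planeWave w r * q i r)) :=
    (integrable_planeWave_mul (hq i) w).const_mul _
  simp only [firstOrderFourier, fourier_eq_integral_planeWave, ← integral_const_mul]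
  rw [← integral_finsetSum _ fun i _ => h i, ← integral_add (integrable_planeWave_mul hp w)
    (integrable_finsetSum _ fun i _ => h i)]
  congr 1
  funext r
  rw [mul_add, Finset.mul_sum]
  congr 1
  exact Finset.sum_congr rfl fun i _ => by ring

/-! ### Piecewise solutions of `D g = 0`. -/

section Piecewise

variable {n : ℕ} {Ω : Fin n → Set Plane} {g : Fin n → Plane → ℂ}

theorem integrable_mul_sum_indicator (hm : ∀ i, NullMeasurableSet (Ω i) volume)
    (hs : ∀ i, Ω i ⊆ unitSquare) (hg : ∀ i, ∀ r ∈ closure (Ω i), ContDiffAt ℝ ∞ (g i) r)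
    {u : Plane → ℂ} (hu : Continuous u) :
    Integrable (fun r => u r * ∑ i, (Ω i).indicator (g i) r) volume := by
  have h (i : Fin n) : Integrable ((Ω i).indicator fun r => u r * g i r) volume :=
    integrable_indicator_of_continuousOn_closure (hm i) (isBounded_unitSquare.subset (hs i))
      fun r hr => (hu.continuousAt.mul (hg i r hr).continuousAt).continuousWithinAt
  refine (integrable_finsetSum Finset.univ fun i _ => h i).congr
    (Filter.Eventually.of_forall fun r => ?_)
  simp only [Finset.mul_sum]
  refine Finset.sum_congr rfl fun i _ => ?_
  by_cases hr : r ∈ Ω i <;> simp [hr]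

theorem fderiv_mul_mul_planeWave {a g : Plane → ℂ} {r : Plane} (ha : DifferentiableAt ℝ a r)
    (hg : DifferentiableAt ℝ g r) (w : Plane) (j : Fin 2) :
    fderiv ℝ (fun r => a r * g r * planeWave w r) r (basisVec j) =
      planeWave w r * (fderiv ℝ a r (basisVec j) * g r + a r * fderiv ℝ g r (basisVec j) -
        Complex.I * w j * (a r * g r)) := by
  rw [fderiv_fun_mul (ha.fun_mul hg) ((contDiff_planeWave w).differentiable (by simp) r),
    fderiv_fun_mul ha hg]
  simp only [_root_.add_apply, _root_.smul_apply, fderiv_planeWave, smul_eq_mul]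
  ring

variable {a : Fin 2 → Plane → ℂ} {b : Plane → ℂ}

theorem continuous_fderiv_apply {a : Plane → ℂ} (ha : a.HasTemperateGrowth) (v : Plane) :
    Continuous fun r => fderiv ℝ a r v :=
  (ha.1.continuous_fderiv (by simp)).clm_apply continuous_const

theorem continuous_sub_sum_fderiv (ha : ∀ i, (a i).HasTemperateGrowth)
    (hb : b.HasTemperateGrowth) :
    Continuous fun r => b r - ∑ j, fderiv ℝ (a j) r (basisVec j) :=
  hb.1.continuous.sub (continuous_finsetSum _ fun j _ => continuous_fderiv_apply (ha j) _)

/-- The Leibniz rule `aⱼ ∂ⱼf = ∂ⱼ(aⱼ f) - (∂ⱼaⱼ) f`, carried out on the test function. -/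
theorem isFourierTransform_diffOpDist (ha : ∀ i, (a i).HasTemperateGrowth)
    (hb : b.HasTemperateGrowth) {f : Plane → ℂ} (hf : Integrable f volume)
    (hfu : ∀ u : Plane → ℂ, Continuous u → Integrable (fun r => u r * f r) volume) :
    IsFourierTransform (diffOpDist a b (regularDist f hf))
      (firstOrderFourier (fun r => (b r - ∑ j, fderiv ℝ (a j) r (basisVec j)) * f r)
        fun j r => a j r * f r) := by
  have hac (j : Fin 2) : Integrable (fun r => a j r * f r) volume := hfu _ (ha j).1.continuous
  have hbc : Integrable (fun r => b r * f r) volume := hfu _ hb.1.continuous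
  have hdc (j : Fin 2) : Integrable (fun r => fderiv ℝ (a j) r (basisVec j) * f r) volume :=
    hfu _ (continuous_fderiv_apply (ha j) _)
  refine isFourierTransform_firstOrderFourier (hfu _ (continuous_sub_sum_fderiv ha hb)) hac fun φ => ?_
  rw [diffOpDist_regularDist_apply ha hb]
  have h1 (j : Fin 2) : ∫ r, fderiv ℝ (fun x => a j x * φ x) r (basisVec j) * f r =
      (∫ r, φ r * (fderiv ℝ (a j) r (basisVec j) * f r)) +
        ∫ r, (∂_{basisVec j} φ) r * (a j r * f r) := by
    rw [← integral_add (integrable_schwartz_mul (hdc j) φ) (integrable_schwartz_mul (hac j) _)]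
    congr 1
    funext r
    rw [fderiv_fun_mul ((ha j).1.differentiable (by simp) r) φ.differentiableAt,
      SchwartzMap.lineDerivOp_apply_eq_fderiv]
    simp only [_root_.add_apply, _root_.smul_apply, smul_eq_mul]
    ring
  have h2 : ∫ r, φ r * ((b r - ∑ j, fderiv ℝ (a j) r (basisVec j)) * f r) =
      (∫ r, b r * φ r * f r) - ∑ j, ∫ r, φ r * (fderiv ℝ (a j) r (basisVec j) * f r) := by
    have h3 : Integrable (fun r => b r * φ r * f r) volume :=
      (integrable_schwartz_mul hbc φ).congr (Filter.Eventually.of_forall fun r => by ring)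
    rw [← integral_finsetSum _ fun j _ => integrable_schwartz_mul (hdc j) φ, ← integral_sub h3
      (integrable_finsetSum _ fun j _ => integrable_schwartz_mul (hdc j) φ)]
    congr 1
    funext r
    simp only [Fin.sum_univ_two]
    ring
  rw [h2, Finset.sum_congr rfl fun j _ => h1 j, Finset.sum_add_distrib]
  ring

theorem contDiffAt_mul_mul {a g ψ : Plane → ℂ} (ha : a.HasTemperateGrowth) (hψ : ContDiff ℝ ∞ ψ)
    {r : Plane} (hg : ContDiffAt ℝ ∞ g r) : ContDiffAt ℝ 1 (fun r => a r * g r * ψ r) r :=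
  ((ha.1.contDiffAt.mul hg).mul hψ.contDiffAt).of_le (by exact_mod_cast le_top)

theorem integrable_indicator_fderiv {Ω : Set Plane} (hm : NullMeasurableSet Ω volume)
    (hb : Bornology.IsBounded Ω) {h : Plane → ℂ} (hd : ∀ r ∈ closure Ω, ContDiffAt ℝ 1 h r)
    (v : Plane) : Integrable (Ω.indicator fun r => fderiv ℝ h r v) volume :=
  integrable_indicator_of_continuousOn_closure hm hb fun r hr =>
    (((hd r hr).fderiv_right (m := 0) (by norm_num)).continuousAt.clm_apply
      continuousAt_const).continuousWithinAt

/-- On `Ωᵢ`, `(b - ∑ ∂ⱼaⱼ + ∑ j wⱼ aⱼ) gᵢ e = (D gᵢ) e - ∑ ∂ⱼ(aⱼ gᵢ e)`, and the first term on the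
right vanishes. -/
theorem firstOrderFourier_eq_sum_integral_indicator (ha : ∀ i, (a i).HasTemperateGrowth)
    (hb : b.HasTemperateGrowth) (hm : ∀ i, NullMeasurableSet (Ω i) volume)
    (hs : ∀ i, Ω i ⊆ unitSquare) (hg : ∀ i, ∀ r ∈ closure (Ω i), ContDiffAt ℝ ∞ (g i) r)
    (hD : ∀ i, ∀ r ∈ Ω i, diffOp a b (g i) r = 0) (w : Plane) :
    firstOrderFourier
        (fun r => (b r - ∑ j, fderiv ℝ (a j) r (basisVec j)) * ∑ i, (Ω i).indicator (g i) r)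
        (fun j r => a j r * ∑ i, (Ω i).indicator (g i) r) w =
      -∑ i, ∑ j, ∫ r, (Ω i).indicator
        (fun r => fderiv ℝ (fun r => a j r * g i r * planeWave w r) r (basisVec j)) r := by
  have hi (i : Fin n) (j : Fin 2) := integrable_indicator_fderiv (hm i)
    (isBounded_unitSquare.subset (hs i))
    (fun r hr => contDiffAt_mul_mul (ha j) (contDiff_planeWave w) (hg i r hr)) (basisVec j)
  rw [firstOrderFourier_eq_integral
    (integrable_mul_sum_indicator hm hs hg (continuous_sub_sum_fderiv ha hb))
    (fun j => integrable_mul_sum_indicator hm hs hg (ha j).1.continuous),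
    Finset.sum_congr rfl fun i _ => (integral_finsetSum _ fun j _ => hi i j).symm,
    ← integral_finsetSum _ fun i _ => integrable_finsetSum _ fun j _ => hi i j, ← integral_neg]
  congr 1
  funext r
  have key (i : Fin n) : planeWave w r * ((b r - ∑ j, fderiv ℝ (a j) r (basisVec j) +
      ∑ j, Complex.I * w j * a j r) * (Ω i).indicator (g i) r) =
      -∑ j, (Ω i).indicator
        (fun r => fderiv ℝ (fun r => a j r * g i r * planeWave w r) r (basisVec j)) r := by
    by_cases hr : r ∈ Ω i
    · have h0 := hD i r hr
      have hgd := (hg i r (subset_closure hr)).differentiableAt (by simp)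
      simp only [Set.indicator_of_mem hr, Fin.sum_univ_two, diffOp,
        fderiv_mul_mul_planeWave ((ha _).1.differentiable (by simp) r) hgd] at h0 ⊢
      linear_combination planeWave w r * h0
    · simp [hr]
  rw [← Finset.sum_neg_distrib, ← Finset.sum_congr rfl fun i _ => key i, ← Finset.mul_sum,
    ← Finset.mul_sum]
  simp only [Fin.sum_univ_two]
  ring

theorem fourierAnnihilated_diffOpDist (ha : ∀ i, (a i).HasTemperateGrowth)
    (hb : b.HasTemperateGrowth) {Λ : Finset (Fin 2 → ℤ)} {c : (Fin 2 → ℤ) → ℂ}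
    (hm : ∀ i, NullMeasurableSet (Ω i) volume) (hs : ∀ i, Ω i ⊆ unitSquare)
    (h0 : ∀ i, frontier (Ω i) ⊆ {r | trigPoly Λ c r = 0})
    (hg : ∀ i, ∀ r ∈ closure (Ω i), ContDiffAt ℝ ∞ (g i) r)
    (hD : ∀ i, ∀ r ∈ Ω i, diffOp a b (g i) r = 0) :
    ∃ hf : Integrable (fun r => ∑ i, (Ω i).indicator (g i) r) volume,
      FourierAnnihilated Λ c (diffOpDist a b (regularDist _ hf)) := by
  have hf : Integrable (fun r => ∑ i, (Ω i).indicator (g i) r) volume := by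
    simpa using integrable_mul_sum_indicator hm hs hg (u := fun _ => 1) continuous_const
  have hF := isFourierTransform_diffOpDist ha hb hf
    fun u hu => integrable_mul_sum_indicator hm hs hg hu
  refine ⟨hf, ⟨_, hF⟩, fun F hF' w => ?_⟩
  rw [hF'.unique hF]
  simp only [firstOrderFourier_eq_sum_integral_indicator ha hb hm hs hg hD]
  simp only [mul_neg, Finset.sum_neg_distrib, Finset.mul_sum, neg_eq_zero]
  rw [Finset.sum_comm]
  refine Finset.sum_eq_zero fun i _ => ?_
  rw [Finset.sum_comm]
  refine Finset.sum_eq_zero fun j _ => ?_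
  have hbd := isBounded_unitSquare.subset (hs i)
  -- This is `e μ`. The sum form lets the derivative be taken term by term.
  let ψ : Plane → ℂ := fun r => ∑ k ∈ Λ, c k * planeWave (w - freq k) r
  have hψ : ContDiff ℝ ∞ ψ :=
    ContDiff.sum fun k _ => contDiff_const.mul (contDiff_planeWave _)
  have hd (k : Fin 2 → ℤ) (r : Plane) (hr : r ∈ closure (Ω i)) :=
    contDiffAt_mul_mul (ha j) (contDiff_planeWave (w - freq k)) (hg i r hr)
  have hz := integral_indicator_fderiv_eq_zero (hm i) hbd
    (fun r hr => contDiffAt_mul_mul (ha j) hψ (hg i r hr))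
    (fun r hr => by
      simp only [ψ, sum_mul_planeWave_sub_freq]
      rw [show trigPoly Λ c r = 0 from h0 i hr, mul_zero, mul_zero]) j
  rw [← hz]
  simp only [← integral_const_mul]
  rw [← integral_finsetSum _ fun k _ => (integrable_indicator_fderiv (hm i) hbd (hd k) _).const_mul _]
  congr 1
  funext r
  by_cases hr : r ∈ Ω i
  · have hdk (k : Fin 2 → ℤ) := (hd k r (subset_closure hr)).differentiableAt one_ne_zero
    have he : (fun r => a j r * g i r * ψ r) =
        fun r => ∑ k ∈ Λ, c k * (a j r * g i r * planeWave (w - freq k) r) := by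
      funext r
      simp only [ψ, Finset.mul_sum]
      exact Finset.sum_congr rfl fun k _ => by ring
    simp only [Set.indicator_of_mem hr]
    rw [he, fderiv_fun_sum fun k _ => (hdk k).const_mul (c k), sum_apply]
    refine Finset.sum_congr rfl fun k _ => ?_
    rw [fderiv_const_mul (hdk k), _root_.smul_apply, smul_eq_mul]
  · simp [hr]

end Piecewise

theorem mainTheorem3
    (Λ : Finset (Fin 2 → ℤ)) (c : (Fin 2 → ℤ) → ℂ)
    (a : Fin 2 → Plane → ℂ) (ha : ∀ i, (a i).HasTemperateGrowth) :
    (∀ Ω : Set Plane, NullMeasurableSet Ω volume → Ω ⊆ unitSquare →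
      frontier Ω ⊆ {r | trigPoly Λ c r = 0} →
      ∃ hf : Integrable (Ω.indicator (fun _ => (1 : ℂ))) volume,
        FourierAnnihilated Λ c (diffOpDist a (fun _ => 0) (regularDist _ hf))) ∧
    (∀ (b : Plane → ℂ), b.HasTemperateGrowth →
      ∀ (n : ℕ) (Ω : Fin n → Set Plane) (g : Fin n → Plane → ℂ),
      (∀ i, NullMeasurableSet (Ω i) volume) → (∀ i, Ω i ⊆ unitSquare) →
      (∀ i, frontier (Ω i) ⊆ {r | trigPoly Λ c r = 0}) →
      (∀ i, ∀ r ∈ closure (Ω i), ContDiffAt ℝ ∞ (g i) r) →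
      (∀ i, ∀ r ∈ Ω i, diffOp a b (g i) r = 0) →
      ∃ hf : Integrable (fun r => ∑ i, (Ω i).indicator (g i) r) volume,
        FourierAnnihilated Λ c (diffOpDist a b (regularDist _ hf))) := by
  refine ⟨fun Ω hm hs h0 => ?_, fun b hb n Ω g hm hs h0 hg hD =>
    fourierAnnihilated_diffOpDist ha hb hm hs h0 hg hD⟩
  -- Without a zeroth-order term, constants solve `D g = 0`.
  have h := fourierAnnihilated_diffOpDist (n := 1) (Ω := fun _ => Ω) (g := fun _ _ => 1)
    (b := fun _ => 0) (Λ := Λ) (c := c) ha (.const 0) (fun _ => hm) (fun _ => hs) (fun _ => h0)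
    (fun _ _ _ => contDiffAt_const) (fun _ r _ => by simp [diffOp])
  simpa only [Fin.sum_univ_one] using h
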